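/- Fix a countably infinite set $U$ (the universe). A database schema $\tau$ is a finite nonempty set of relation symbols with arities in $\mathbb{N}$ (arity $0$ is allowed). A $\tau$-fact is an expression $R(u_1,\dots,u_{\mathrm{ar}(R)})$ with $R\in\tau$ and $u_i\in U$, and a $\tau$-instance is a finite set of $\tau$-facts. A probabilistic database (PDB) of schema $\tau$ is a probability space $(\mathbb{D},P)$ where $\mathbb{D}$ is a countable nonempty set of $\tau$-instances. It is tuple-independent if, for all pairwise distinct facts $f_1,\dots,f_k$ that each occur in some instance of positive probability, $\Pr(f_1\in D,\dots,f_k\in D)=\prod_{i=1}^k\Pr(f_i\in D)$. Let $\mathrm{TI}$ be the class of all tuple-independent PDBs over $U$, of arbitrary schema. First-order formulae over $\tau$ may use equality and constants from $U$, and have active domain semantics: when $\Phi$ is evaluated on an instance $D$, the quantifiers and the values of the free variables range over $\mathrm{adom}(D,\Phi)$, the set of elements of $U$ that appear in $D$ or as constants in $\Phi$. An FO-view from $\tau$ to a schema $\tau'$ consists of one first-order formula $\Phi_R(x_1,\dots,x_{\mathrm{ar}(R)})$ over $\tau$ for each $R\in\tau'$; it maps a $\tau$-instance $D$ to the $\tau'$-instance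 $$\Phi(D)=\{R(\bar a) : R\in\tau',\ \bar a\in \mathrm{adom}(D,\Phi_R)^{\mathrm{ar}(R)},\ D\models\Phi_R(\bar a)\}.$$ A PDB $(\mathbb{D}',P')$ is the image of a PDB $(\mathbb{D},P)$ under $\Phi$ if $\Phi(\mathbb{D})\subseteq\mathbb{D}'$ and $P'(\{D'\})=P(\{D\in\mathbb{D} : \Phi(D)=D'\})$ for all $D'\in\mathbb{D}'$. For a PDB $(\mathbb{D},P)$ and a first-order sentence $\varphi$ over its schema with $P(\{D\in\mathbb{D} : D\models\varphi\})>0$, the conditioned PDB has the sample space $\mathbb{D}_\varphi=\{D\in\mathbb{D} : D\models\varphi\}$ and the probabilities $P(\{D\})/P(\mathbb{D}_\varphi)$ for $D\in\mathbb{D}_\varphi$. For a class $\mathbf{C}$ of PDBs over $U$, let $\mathrm{FO}(\mathbf{C})$ be the class of all images of PDBs in $\mathbf{C}$ under FO-views, and let $\mathbf{C}\mid\mathrm{FO}$ be the class of all PDBs obtained by conditioning a PDB in $\mathbf{C}$ on a first-order sentence of positive probability. **Theorem.** $\mathrm{FO}(\mathrm{TI}\mid\mathrm{FO})=\mathrm{FO}(\mathrm{TI})$.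 -/

import Mathlib

open scoped ENNReal

namespace ProbDB

/-- A database schema: a finite, nonempty collection of relation symbols with arities
(arity `0` is allowed). -/
structure Schema where
  Rel : Type
  [fintypeRel : Fintype Rel]
  [nonemptyRel : Nonempty Rel]
  arity : Rel → ℕ

attribute [instance] Schema.fintypeRel Schema.nonemptyRel

/-- A fact `R(u₁, …, u_{ar(R)})` over the universe `U`. -/
structure Fact (U : Type*) (τ : Schema) where
  rel : τ.Rel
  args : Fin (τ.arity rel) → U

/-- A database instance is a finite set of facts. -/
abbrev Instance (U : Type*) (τ : Schema) := Finset (Fact U τ)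

open scoped Classical in
/-- The active domain of an instance: the elements of the universe that appear in its facts. -/
noncomputable def Instance.adom {U : Type*} {τ : Schema} (D : Instance U τ) : Finset U :=
  D.biUnion fun f => Finset.univ.image f.args

/-- A term is one of the `n` variables in scope or a constant from the universe. -/
inductive Term (U : Type*) (n : ℕ)
  | var (i : Fin n) : Term U n
  | const (u : U) : Term U n

/-- The value of a term under a valuation of the variables in scope. -/
def Term.val {U : Type*} {n : ℕ} (v : Fin n → U) : Term U n → U
  | .var i => v i
  | .const u => u

open scoped Classical in
/-- The constants appearing in a term. -/
noncomputable def Term.consts {U : Type*} {n : ℕ} : Term U n → Finset U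
  | .var _ => ∅
  | .const u => {u}

/-- First-order formulae over the schema `τ`, with constants from `U` and with free variables
among `x₀, …, x_{n-1}`. A quantifier binds the variable with the last index `n` of its body. -/
inductive Formula (U : Type*) (τ : Schema) : ℕ → Type _
  | rel {n : ℕ} (R : τ.Rel) (t : Fin (τ.arity R) → Term U n) : Formula U τ n
  | eq {n : ℕ} (s t : Term U n) : Formula U τ n
  | neg {n : ℕ} (φ : Formula U τ n) : Formula U τ n
  | and {n : ℕ} (φ ψ : Formula U τ n) : Formula U τ n
  | or {n : ℕ} (φ ψ : Formula U τ n) : Formula U τ n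
  | ex {n : ℕ} (φ : Formula U τ (n + 1)) : Formula U τ n
  | all {n : ℕ} (φ : Formula U τ (n + 1)) : Formula U τ n

/-- First-order sentences: formulae without free variables. -/
abbrev Sentence (U : Type*) (τ : Schema) := Formula U τ 0

namespace Formula

open scoped Classical in
/-- The set of constants appearing in a formula. -/
noncomputable def consts {U : Type*} {τ : Schema} : {n : ℕ} → Formula U τ n → Finset U
  | _, .rel _ t => Finset.univ.biUnion fun i => (t i).consts
  | _, .eq s t => s.consts ∪ t.consts
  | _, .neg φ => φ.consts
  | _, .and φ ψ => φ.consts ∪ ψ.consts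
  | _, .or φ ψ => φ.consts ∪ ψ.consts
  | _, .ex φ => φ.consts
  | _, .all φ => φ.consts

/-- Truth of a formula in the instance `D` under the valuation `v`, where the quantifiers range
over the set `A`. -/
def Holds {U : Type*} {τ : Schema} (A : Finset U) (D : Instance U τ) :
    {n : ℕ} → Formula U τ n → (Fin n → U) → Prop
  | _, .rel R t, v => (⟨R, fun i => (t i).val v⟩ : Fact U τ) ∈ D
  | _, .eq s t, v => s.val v = t.val v
  | _, .neg φ, v => ¬ φ.Holds A D v
  | _, .and φ ψ, v => φ.Holds A D v ∧ ψ.Holds A D v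
  | _, .or φ ψ, v => φ.Holds A D v ∨ ψ.Holds A D v
  | _, .ex φ, v => ∃ a ∈ A, φ.Holds A D (Fin.snoc v a)
  | _, .all φ, v => ∀ a ∈ A, φ.Holds A D (Fin.snoc v a)

open scoped Classical in
/-- `adom(D, Φ)`: the active domain of `D` together with the constants of `Φ`. -/
noncomputable def adom {U : Type*} {τ : Schema} {n : ℕ} (D : Instance U τ) (Φ : Formula U τ n) :
    Finset U :=
  D.adom ∪ Φ.consts

open scoped Classical in
/-- The answers of a formula on `D` under the active domain semantics: all tuples over
`adom(D, Φ)` that satisfy `Φ` in `D`, with the quantifiers ranging over `adom(D, Φ)`. -/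
noncomputable def answers {U : Type*} {τ : Schema} {n : ℕ} (Φ : Formula U τ n)
    (D : Instance U τ) : Finset (Fin n → U) :=
  (Fintype.piFinset fun _ => Φ.adom D).filter fun a => Φ.Holds (Φ.adom D) D a

end Formula

/-- `D ⊨ φ` for a sentence `φ`, under the active domain semantics. -/
def Models {U : Type*} {τ : Schema} (D : Instance U τ) (φ : Sentence U τ) : Prop :=
  φ.Holds (φ.adom D) D Fin.elim0

/-- An FO-view from schema `τ` to schema `τ'`: for each relation symbol of `τ'` a first-order
formula over `τ`, with as many free variables as the arity of the symbol. -/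
def FOView (U : Type*) (τ τ' : Schema) := (R : τ'.Rel) → Formula U τ (τ'.arity R)

open scoped Classical in
/-- The result of an FO-view on an instance. -/
noncomputable def FOView.apply {U : Type*} {τ τ' : Schema} (Φ : FOView U τ τ')
    (D : Instance U τ) : Instance U τ' :=
  Finset.univ.biUnion fun R => ((Φ R).answers D).image fun a => (⟨R, a⟩ : Fact U τ')

/-- A probabilistic database of schema `τ` over `U`: a discrete probability space whose sample
space is a countable set of `τ`-instances. The distribution is given by its probability mass
function, extended by `0` outside of the sample space. -/
structure PDB (U : Type*) (τ : Schema) where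
  space : Set (Instance U τ)
  countable_space : space.Countable
  prob : PMF (Instance U τ)
  support_subset : prob.support ⊆ space

namespace PDB

/-- The probability of the event that a random instance lies in `A`. -/
noncomputable def Pr {U : Type*} {τ : Schema} (D : PDB U τ) (A : Set (Instance U τ)) : ℝ≥0∞ :=
  D.prob.toOuterMeasure A

/-- The set of all facts that appear in instances of positive probability. -/
def facts {U : Type*} {τ : Schema} (D : PDB U τ) : Set (Fact U τ) :=
  {f | ∃ I ∈ D.prob.support, f ∈ I}

/-- Tuple-independence: for pairwise distinct facts `f₁, …, f_k` of the PDB, the probability that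
all of them belong to a random instance is the product of their marginal probabilities. -/
def TupleIndependent {U : Type*} {τ : Schema} (D : PDB U τ) : Prop :=
  ∀ S : Finset (Fact U τ), (∀ f ∈ S, f ∈ D.facts) →
    D.Pr {I | ∀ f ∈ S, f ∈ I} = ∏ f ∈ S, D.Pr {I | f ∈ I}

theorem exists_mem_support {U : Type*} {τ : Schema} (D : PDB U τ) {A : Set (Instance U τ)}
    (h : 0 < D.Pr A) : ∃ I ∈ A, I ∈ D.prob.support := by
  by_contra hne
  push Not at hne
  refine h.ne' ?_
  rw [Pr, PMF.toOuterMeasure_apply_eq_zero_iff, Set.disjoint_left]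
  exact fun I hI hA => hne I hA hI

/-- Conditioning on a sentence `φ` of positive probability: the sample space is restricted to the
instances satisfying `φ`, and the probabilities are divided by the probability of `φ`. -/
noncomputable def cond {U : Type*} {τ : Schema} (D : PDB U τ) (φ : Sentence U τ)
    (h : 0 < D.Pr {I | Models I φ}) : PDB U τ where
  space := {I ∈ D.space | Models I φ}
  countable_space := D.countable_space.mono (Set.sep_subset _ _)
  prob := D.prob.filter {I | Models I φ} (D.exists_mem_support h)
  support_subset := by
    intro I hI
    rw [PMF.support_filter] at hI
    exact ⟨D.support_subset hI.2, hI.1⟩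

end PDB

/-- `E = Φ(D)`: the view `Φ` maps the sample space of `D` to that of `E`, and the distribution
of `E` is the image of that of `D`. -/
def FOView.IsImage {U : Type*} {τ τ' : Schema} (Φ : FOView U τ τ') (D : PDB U τ)
    (E : PDB U τ') : Prop :=
  Set.MapsTo Φ.apply D.space E.space ∧ E.prob = D.prob.map Φ.apply

/-- Classes of PDBs over the universe `U`, of arbitrary schemas. -/
abbrev PDBClass (U : Type*) := Set (Σ τ : Schema, PDB U τ)

/-- The class `TI` of tuple-independent PDBs. -/
def TI (U : Type*) : PDBClass U := {D | D.2.TupleIndependent}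

/-- The class `FO(C)` of images of `C`-PDBs under FO-views. -/
def FO {U : Type*} (C : PDBClass U) : PDBClass U :=
  {E | ∃ D ∈ C, ∃ Φ : FOView U D.1 E.1, Φ.IsImage D.2 E.2}

/-- The class `C | FO` of PDBs obtained by conditioning a `C`-PDB on an FO-sentence of positive
probability. -/
def CondFO {U : Type*} (C : PDBClass U) : PDBClass U :=
  {E | ∃ D ∈ C, ∃ (φ : Sentence U D.1) (h : 0 < D.2.Pr {I | Models I φ}),
    E = ⟨D.1, D.2.cond φ h⟩}

end ProbDB

/-! Only removing the conditioning takes work. Rejection sampling would realise it, but it has no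
bound on the number of samples, while a view sees one finite product of databases. The remedy is to
fix an instance `D₀` of positive probability satisfying the condition `t`, and to put s = t \ {D₀}.
Draw k independent instances and return the first one in s, or `D₀` if there is none. An instance a
in s is returned with probability P(a)(1 + q + … + q^(k-1)), where q = 1 - P(s). As k grows the
factor tends to 1/P(s), possibly infinite, and this exceeds 1/P(t) because P(D₀) > 0. So some finite
k overshoots 1/P(t). A biased coin, which on one side returns `D₀` outright, scales the factor down
to exactly 1/P(t), and `D₀` receives the right mass because the total is 1
(`PMF.exists_filter_eq_bind`).

The k copies and the coin form a tuple-independent PDB over a disjoint union of schemas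
(`PDB.TupleIndependent.prod`), and the selection is first-order (`TIRepresentable.ite`). On the
union, quantifiers range over more than the active domain of one copy. This is why `Definable` asks
for a formula insensitive to the range. `Definable.holds` provides such formulae for active domain
semantics, and `DefinableMap.exists_view` leads back to views. -/

namespace ProbDB

/-! ### Properties definable independently of the quantifier range -/

variable {U : Type*} {τ τ' σ : Schema} {n : ℕ}

/-- A property of instances and valuations is definable if some formula expresses it whenever the
quantifiers range over a sufficiently large finite set, no matter which one. -/
def Definable (p : Instance U τ → (Fin n → U) → Prop) : Prop :=
  ∃ (ψ : Formula U τ n) (C : Finset U), ∀ (A : Finset U) (D : Instance U τ) (v : Fin n → U),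
    D.adom ⊆ A → C ⊆ A → (∀ i, v i ∈ A) → (ψ.Holds A D v ↔ p D v)

theorem Instance.mem_adom {D : Instance U τ} {a : U} :
    a ∈ D.adom ↔ ∃ f ∈ D, ∃ i, f.args i = a := by
  simp [Instance.adom]

namespace Definable

theorem congr {p q : Instance U τ → (Fin n → U) → Prop} (hp : Definable p)
    (h : ∀ D v, p D v ↔ q D v) : Definable q := by
  obtain rfl : p = q := by ext D v; exact h D v
  exact hp

theorem rel (R : τ.Rel) (t : Fin (τ.arity R) → Term U n) :
    Definable fun (D : Instance U τ) v => (⟨R, fun i => (t i).val v⟩ : Fact U τ) ∈ D :=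
  ⟨.rel R t, ∅, fun _ _ _ _ _ _ => Iff.rfl⟩

theorem eq (s t : Term U n) : Definable fun (_ : Instance U τ) v => s.val v = t.val v :=
  ⟨.eq s t, ∅, fun _ _ _ _ _ _ => Iff.rfl⟩

theorem neg {p : Instance U τ → (Fin n → U) → Prop} (hp : Definable p) :
    Definable fun D v => ¬ p D v := by
  obtain ⟨ψ, C, h⟩ := hp
  exact ⟨.neg ψ, C, fun A D v hA hC hv => not_congr (h A D v hA hC hv)⟩

open scoped Classical in
theorem and {p q : Instance U τ → (Fin n → U) → Prop} (hp : Definable p) (hq : Definable q) :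
    Definable fun D v => p D v ∧ q D v := by
  obtain ⟨ψ, C, h⟩ := hp
  obtain ⟨χ, B, k⟩ := hq
  exact ⟨.and ψ χ, C ∪ B, fun A D v hA hC hv =>
    and_congr (h A D v hA (Finset.union_subset_left hC) hv)
      (k A D v hA (Finset.union_subset_right hC) hv)⟩

theorem or {p q : Instance U τ → (Fin n → U) → Prop} (hp : Definable p) (hq : Definable q) :
    Definable fun D v => p D v ∨ q D v :=
  (hp.neg.and hq.neg).neg.congr fun D v => by tauto

theorem const (b : Prop) : Definable fun (_ : Instance U τ) (_ : Fin n → U) => b := by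
  have h : Definable fun (_ : Instance U τ) (_ : Fin n → U) => True :=
    ⟨.all (.eq (.var 0) (.var 0)), ∅, fun _ _ _ _ _ _ => by simp [Formula.Holds]⟩
  by_cases hb : b
  · exact h.congr fun _ _ => by simp [hb]
  · exact h.neg.congr fun _ _ => by simp [hb]

open scoped Classical in
theorem exists_mem {ι : Type*} (s : Finset ι) {p : ι → Instance U τ → (Fin n → U) → Prop}
    (hp : ∀ i ∈ s, Definable (p i)) : Definable fun D v => ∃ i ∈ s, p i D v := by
  induction s using Finset.induction_on with
  | empty => exact (const False).congr fun _ _ => by simp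
  | insert i s _ ih =>
    exact ((hp i (by simp)).or (ih fun j hj => hp j (by simp [hj]))).congr fun _ _ => by simp

theorem forall_mem {ι : Type*} (s : Finset ι) {p : ι → Instance U τ → (Fin n → U) → Prop}
    (hp : ∀ i ∈ s, Definable (p i)) : Definable fun D v => ∀ i ∈ s, p i D v :=
  (exists_mem s fun i hi => (hp i hi).neg).neg.congr fun _ _ => by simp

/-- Bounded existential quantification. -/
theorem ex {p : Instance U τ → (Fin (n + 1) → U) → Prop} (hp : Definable p) (B : Finset U)
    (hB : ∀ D v a, p D (Fin.snoc v a) → a ∈ D.adom ∨ a ∈ B) :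
    Definable fun D v => ∃ a, p D (Fin.snoc v a) := by
  classical
  obtain ⟨ψ, C, h⟩ := hp
  refine ⟨.ex ψ, C ∪ B, fun A D v hA hC hv => ?_⟩
  have key : ∀ a ∈ A, (ψ.Holds A D (Fin.snoc v a) ↔ p D (Fin.snoc v a)) := fun a ha =>
    h A D _ hA (Finset.union_subset_left hC) fun i => by
      induction i using Fin.lastCases with
      | last => simpa using ha
      | cast i => simpa using hv i
  constructor
  · rintro ⟨a, ha, h⟩
    exact ⟨a, (key a ha).1 h⟩
  · rintro ⟨a, h⟩
    have ha : a ∈ A := (hB D v a h).elim (fun h => hA h) fun h => Finset.union_subset_right hC h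
    exact ⟨a, ha, (key a ha).2 h⟩

theorem ex_tuple {k : ℕ} {p : Instance U τ → (Fin (n + k) → U) → Prop} (hp : Definable p)
    (hB : ∀ D (v : Fin n → U) (x : Fin k → U), p D (Fin.append v x) → ∀ i, x i ∈ D.adom) :
    Definable fun D (v : Fin n → U) => ∃ x : Fin k → U, p D (Fin.append v x) := by
  induction k with
  | zero =>
    refine hp.congr fun D v => ⟨fun h => ⟨Fin.elim0, by simpa using h⟩, ?_⟩
    rintro ⟨x, h⟩
    obtain rfl : x = Fin.elim0 := Subsingleton.elim _ _
    simpa using h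
  | succ k ih =>
    have happ : ∀ (v : Fin n → U) (x : Fin k → U) (a : U),
        (Fin.snoc (Fin.append v x) a : Fin (n + k + 1) → U) =
          (Fin.append v (Fin.snoc x a : Fin (k + 1) → U) : Fin (n + (k + 1)) → U) :=
      fun v x a => (Fin.append_snoc v x a).symm
    have h1 : Definable fun D (w : Fin (n + k) → U) => ∃ a, p D (Fin.snoc w a) := by
      refine ex (p := p) hp ∅ fun D w a h => Or.inl ?_
      rw [← Fin.append_castAdd_natAdd (f := w), happ] at h
      simpa using hB _ _ _ h (Fin.last k)
    refine (ih h1 ?_).congr fun D v => ⟨?_, ?_⟩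
    · rintro D v x ⟨a, h⟩ i
      rw [happ] at h
      simpa using hB _ _ _ h i.castSucc
    · rintro ⟨x, a, h⟩
      exact ⟨_, happ v x a ▸ h⟩
    · rintro ⟨x, h⟩
      refine ⟨Fin.init x, x (Fin.last k), ?_⟩
      rw [happ, Fin.snoc_init_self]
      exact h

/-- Witnesses that are the arguments of a fact of `D` lie in `D.adom`, so no bound on `p` itself is
needed. -/
theorem ex_fact (R : τ.Rel) {p : Instance U τ → (Fin (n + τ.arity R) → U) → Prop}
    (hp : Definable p) :
    Definable fun D (v : Fin n → U) =>
      ∃ x, (⟨R, x⟩ : Fact U τ) ∈ D ∧ p D (Fin.append v x) := by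
  refine (ex_tuple ((rel R fun i => .var (Fin.natAdd n i)).and hp) ?_).congr fun D v => ?_
  · rintro D v x ⟨h, -⟩ i
    simp only [Term.val, Fin.append_right] at h
    exact Instance.mem_adom.2 ⟨_, h, i, rfl⟩
  · simp [Term.val]

theorem mem_adom (i : Fin n) : Definable fun (D : Instance U τ) v => v i ∈ D.adom := by
  have h : ∀ R ∈ (Finset.univ : Finset τ.Rel), Definable fun (D : Instance U τ) v =>
      ∃ x, (⟨R, x⟩ : Fact U τ) ∈ D ∧ ∃ j ∈ (Finset.univ : Finset (Fin (τ.arity R))),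
        Term.val (Fin.append v x) (.var (Fin.natAdd n j)) =
          Term.val (Fin.append v x) (.var (Fin.castAdd _ i)) := fun R _ =>
    ex_fact R (p := fun _ w => ∃ j ∈ (Finset.univ : Finset (Fin (τ.arity R))),
        Term.val w (.var (Fin.natAdd n j)) = Term.val w (.var (Fin.castAdd _ i)))
      (exists_mem _ fun j _ => eq _ _)
  refine (exists_mem _ h).congr fun D v => ?_
  simp only [Finset.mem_univ, true_and, Term.val, Fin.append_left, Fin.append_right,
    Instance.mem_adom]
  constructor
  · rintro ⟨R, x, h, j, hj⟩
    exact ⟨_, h, j, hj⟩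
  · rintro ⟨⟨R, x⟩, h, j, hj⟩
    exact ⟨R, x, h, j, hj⟩

theorem mem_finset (C : Finset U) (i : Fin n) :
    Definable fun (_ : Instance U τ) v => v i ∈ C :=
  (exists_mem C fun c _ => eq (.var i) (.const c)).congr fun D v => by simp [Term.val]

open scoped Classical in
theorem ex_adom (C : Finset U) {p : Instance U τ → (Fin (n + 1) → U) → Prop} (hp : Definable p) :
    Definable fun D v => ∃ a ∈ D.adom ∪ C, p D (Fin.snoc v a) := by
  refine (ex (((mem_adom (Fin.last n)).or (mem_finset C (Fin.last n))).and hp) C ?_).congr ?_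
  · rintro D v a ⟨h, -⟩
    simpa using h
  · intro D v
    simp

open scoped Classical in
/-- Active domain semantics is definable. -/
theorem holds (C : Finset U) (φ : Formula U τ n) :
    Definable fun D v => φ.Holds (D.adom ∪ C) D v := by
  induction φ with
  | rel R t => exact rel R t
  | eq s t => exact eq s t
  | neg φ ih => exact ih.neg
  | and φ ψ ih jh => exact ih.and jh
  | or φ ψ ih jh => exact ih.or jh
  | ex φ ih => exact ex_adom C ih
  | all φ ih => exact (ex_adom C ih.neg).neg.congr fun D v => by simp [Formula.Holds]

theorem models (φ : Sentence U τ) :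
    Definable fun (D : Instance U τ) (_ : Fin 0 → U) => Models D φ := by
  classical
  refine (holds φ.consts φ).congr fun D v => ?_
  obtain rfl : v = Fin.elim0 := Subsingleton.elim _ _
  simp only [Models, Formula.adom]

theorem mem_fact (f : Fact U τ) : Definable fun (D : Instance U τ) (_ : Fin n → U) => f ∈ D :=
  rel f.rel fun i => .const (f.args i)

theorem mem_instance (E : Instance U τ') (R : τ'.Rel) (ρ : Fin (τ'.arity R) → Fin n) :
    Definable fun (_ : Instance U τ) (v : Fin n → U) =>
      (⟨R, fun i => v (ρ i)⟩ : Fact U τ') ∈ E := by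
  classical
  refine (exists_mem E (p := fun f _ v => f = ⟨R, fun i => v (ρ i)⟩) fun f _ => ?_).congr
    fun D v => by simp
  obtain ⟨S, a⟩ := f
  by_cases h : S = R
  · subst h
    refine (forall_mem Finset.univ fun i _ => eq (.var (ρ i)) (.const (a i))).congr fun D v => ?_
    simp [Term.val, funext_iff, eq_comm]
  · exact (const False).congr fun D v => by simp [h]

theorem subset_instance (D₀ : Instance U τ) :
    Definable fun (D : Instance U τ) (_ : Fin n → U) => D ⊆ D₀ := by
  have h : ∀ R ∈ (Finset.univ : Finset τ.Rel), Definable fun (D : Instance U τ) (v : Fin n → U) =>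
      ∃ x, (⟨R, x⟩ : Fact U τ) ∈ D ∧
        (⟨R, fun i => Fin.append v x (Fin.natAdd n i)⟩ : Fact U τ) ∉ D₀ := fun R _ =>
    ex_fact R (p := fun _ w => (⟨R, fun i => w (Fin.natAdd n i)⟩ : Fact U τ) ∉ D₀)
      (mem_instance D₀ R (Fin.natAdd n)).neg
  refine (exists_mem _ h).neg.congr fun D _ => ?_
  simp only [Finset.mem_univ, true_and, not_exists, not_and, not_not, Fin.append_right]
  exact ⟨fun H f hf => H f.rel f.args hf, fun H R x hf => H hf⟩

/-- Finitely many facts, written with constants, pin down an instance. This allows `D₀` to be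
removed from the conditioning event. -/
theorem eq_instance (D₀ : Instance U τ) :
    Definable fun (D : Instance U τ) (_ : Fin n → U) => D = D₀ :=
  ((subset_instance D₀).and (forall_mem D₀ fun f _ => mem_fact f)).congr fun _ _ =>
    ⟨fun h => Finset.Subset.antisymm h.1 h.2, fun h => h ▸ ⟨subset_rfl, fun _ h => h⟩⟩

end Definable

/-! ### Definable maps and FO-views -/

/-- A map between instances is definable if the facts of its values are, and its values introduce
only finitely many new elements. -/
def DefinableMap (F : Instance U τ → Instance U τ') : Prop :=
  (∀ R, Definable fun D a => (⟨R, a⟩ : Fact U τ') ∈ F D) ∧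
    ∃ C : Finset U, ∀ D, ∀ f ∈ F D, ∀ i, f.args i ∈ D.adom ∨ f.args i ∈ C

/-- Conjuncts c = c enlarge the active domain of a formula without affecting its truth over a given
range. -/
theorem Formula.exists_consts_superset (ψ : Formula U τ n) (C : Finset U) :
    ∃ χ : Formula U τ n, C ⊆ χ.consts ∧ ∀ A D v, χ.Holds A D v ↔ ψ.Holds A D v := by
  classical
  induction C using Finset.induction_on with
  | empty => exact ⟨ψ, by simp, fun _ _ _ => Iff.rfl⟩
  | insert c C _ ih =>
    obtain ⟨χ, hC, h⟩ := ih
    refine ⟨.and χ (.eq (.const c) (.const c)), ?_, fun A D v => ?_⟩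
    · refine Finset.insert_subset ?_ (hC.trans ?_)
      · simp [Formula.consts, Term.consts]
      · simp only [Formula.consts]
        exact fun x hx => Finset.mem_union_left _ hx
    · simp [Formula.Holds, h]

theorem FOView.mem_apply (Φ : FOView U τ τ') (D : Instance U τ) (R : τ'.Rel)
    (a : Fin (τ'.arity R) → U) :
    (⟨R, a⟩ : Fact U τ') ∈ Φ.apply D ↔
      (∀ i, a i ∈ (Φ R).adom D) ∧ (Φ R).Holds ((Φ R).adom D) D a := by
  classical
  simp only [FOView.apply, Finset.mem_biUnion, Finset.mem_univ, true_and, Finset.mem_image,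
    Formula.answers, Finset.mem_filter, Fintype.mem_piFinset]
  constructor
  · rintro ⟨R', b, h, e⟩
    cases e
    exact h
  · exact fun h => ⟨R, a, h, rfl⟩

theorem DefinableMap.exists_view {F : Instance U τ → Instance U τ'} (hF : DefinableMap F) :
    ∃ Φ : FOView U τ τ', Φ.apply = F := by
  classical
  obtain ⟨hF, C, hC⟩ := hF
  have key : ∀ R, ∃ χ : Formula U τ (τ'.arity R), C ⊆ χ.consts ∧ ∀ D a,
      (∀ i, a i ∈ χ.adom D) → (χ.Holds (χ.adom D) D a ↔ (⟨R, a⟩ : Fact U τ') ∈ F D) := by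
    intro R
    obtain ⟨ψ, B, h⟩ := hF R
    -- `B` makes the range large enough for `ψ` to be correct; `C` lets the answers reach the new
    -- elements in values of `F`.
    obtain ⟨χ, hχ, hψ⟩ := ψ.exists_consts_superset (C ∪ B)
    refine ⟨χ, Finset.union_subset_left hχ, fun D a ha => ?_⟩
    rw [hψ]
    refine h _ D a ?_ ((Finset.union_subset_right hχ).trans ?_) ha
    · exact fun x hx => Finset.mem_union_left _ hx
    · exact fun x hx => Finset.mem_union_right _ hx
  choose Φ hΦC hΦ using key
  refine ⟨(Φ : FOView U τ τ'), ?_⟩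
  ext D ⟨R, a⟩
  refine (FOView.mem_apply _ D R a).trans ?_
  refine ⟨fun h => (hΦ R D a h.1).1 h.2, fun h => ?_⟩
  have ha : ∀ i, a i ∈ (Φ R).adom D := fun i =>
    (hC D _ h i).elim (fun h => Finset.mem_union_left _ h)
      fun h => Finset.mem_union_right _ (hΦC R h)
  exact ⟨ha, (hΦ R D a ha).2 h⟩

theorem FOView.definableMap (Φ : FOView U τ τ') : DefinableMap Φ.apply := by
  classical
  refine ⟨fun R => ?_, Finset.univ.biUnion fun R => (Φ R).consts, ?_⟩
  · have h := (Definable.forall_mem (Finset.univ : Finset (Fin (τ'.arity R))) fun i _ =>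
      (Definable.mem_adom (τ := τ) i).or (Definable.mem_finset (Φ R).consts i)).and
        (Definable.holds (Φ R).consts (Φ R))
    refine h.congr fun D v => ?_
    rw [FOView.mem_apply]
    simp only [Finset.mem_univ, true_imp_iff, Formula.adom, Finset.mem_union]
  · rintro D ⟨R, a⟩ h i
    rw [FOView.mem_apply] at h
    refine (Finset.mem_union.1 (h.1 i)).imp_right fun h => ?_
    exact Finset.mem_biUnion.2 ⟨R, Finset.mem_univ _, h⟩

/-! ### Reducts and case distinction -/

/-- `g D` is obtained from `D` by keeping (and renaming) some of the relations. -/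
def IsReduct (g : Instance U σ → Instance U τ) : Prop :=
  ∃ (r : τ.Rel → σ.Rel) (hr : ∀ R, σ.arity (r R) = τ.arity R), ∀ D R (a : Fin (τ.arity R) → U),
    (⟨R, a⟩ : Fact U τ) ∈ g D ↔ (⟨r R, fun i => a (i.cast (hr R))⟩ : Fact U σ) ∈ D

theorem IsReduct.id : IsReduct (fun D : Instance U τ => D) :=
  ⟨fun R => R, fun _ => rfl, fun _ _ _ => Iff.rfl⟩

theorem IsReduct.adom_subset {g : Instance U σ → Instance U τ} (hg : IsReduct g)
    (D : Instance U σ) : (g D).adom ⊆ D.adom := by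
  obtain ⟨r, hr, h⟩ := hg
  intro x hx
  obtain ⟨⟨R, a⟩, hf, i, rfl⟩ := Instance.mem_adom.1 hx
  exact Instance.mem_adom.2 ⟨_, (h D R a).1 hf, i.cast (hr R).symm, rfl⟩

theorem Term.exists_rename {m n : ℕ} (ρ : Fin m → Fin n) (t : Term U m) :
    ∃ s : Term U n, ∀ v : Fin n → U, s.val v = t.val fun i => v (ρ i) := by
  cases t with
  | var i => exact ⟨.var (ρ i), fun _ => rfl⟩
  | const u => exact ⟨.const u, fun _ => rfl⟩

/-- The renaming `ρ` is arbitrary so that the induction can extend it by the bound variable under a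
quantifier. -/
theorem IsReduct.exists_formula {g : Instance U σ → Instance U τ} (hg : IsReduct g) {m : ℕ}
    (ψ : Formula U τ m) : ∀ {n : ℕ} (ρ : Fin m → Fin n), ∃ χ : Formula U σ n,
      ∀ A D v, χ.Holds A D v ↔ ψ.Holds A (g D) fun i => v (ρ i) := by
  have hsnoc : ∀ {m n : ℕ} (ρ : Fin m → Fin n) (v : Fin n → U) (a : U),
      (fun i => (Fin.snoc v a : Fin (n + 1) → U)
        ((Fin.snoc (fun j => (ρ j).castSucc) (Fin.last n) : Fin (m + 1) → Fin (n + 1)) i)) =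
        (Fin.snoc (fun i => v (ρ i)) a : Fin (m + 1) → U) := by
    intro m n ρ v a
    ext i
    induction i using Fin.lastCases <;> simp
  induction ψ with
  | rel R t =>
    intro n ρ
    obtain ⟨r, hr, h⟩ := hg
    choose s hs using fun i => (t i).exists_rename ρ
    refine ⟨.rel (r R) fun i => s (i.cast (hr R)), fun A D v => ?_⟩
    simp only [Formula.Holds, h, hs]
  | eq s t =>
    intro n ρ
    obtain ⟨s', hs⟩ := s.exists_rename ρ
    obtain ⟨t', ht⟩ := t.exists_rename ρ
    exact ⟨.eq s' t', fun A D v => by simp only [Formula.Holds, hs, ht]⟩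
  | neg φ ih =>
    intro n ρ
    obtain ⟨χ, h⟩ := ih ρ
    exact ⟨.neg χ, fun A D v => not_congr (h A D v)⟩
  | and φ ψ ih jh =>
    intro n ρ
    obtain ⟨χ, h⟩ := ih ρ
    obtain ⟨χ', h'⟩ := jh ρ
    exact ⟨.and χ χ', fun A D v => and_congr (h A D v) (h' A D v)⟩
  | or φ ψ ih jh =>
    intro n ρ
    obtain ⟨χ, h⟩ := ih ρ
    obtain ⟨χ', h'⟩ := jh ρ
    exact ⟨.or χ χ', fun A D v => or_congr (h A D v) (h' A D v)⟩
  | ex φ ih =>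
    intro n ρ
    obtain ⟨χ, h⟩ := ih (Fin.snoc (fun j => (ρ j).castSucc) (Fin.last n))
    exact ⟨.ex χ, fun A D v => by simp only [Formula.Holds, h, hsnoc]⟩
  | all φ ih =>
    intro n ρ
    obtain ⟨χ, h⟩ := ih (Fin.snoc (fun j => (ρ j).castSucc) (Fin.last n))
    exact ⟨.all χ, fun A D v => by simp only [Formula.Holds, h, hsnoc]⟩

/-- A range containing `D.adom` also contains the active domain of the reduct, so insensitivity to
the range does the work. -/
theorem Definable.comp {m : ℕ} {p : Instance U τ → (Fin m → U) → Prop} (hp : Definable p)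
    {g : Instance U σ → Instance U τ} (hg : IsReduct g) (ρ : Fin m → Fin n) :
    Definable fun D v => p (g D) fun i => v (ρ i) := by
  obtain ⟨ψ, C, h⟩ := hp
  obtain ⟨χ, hχ⟩ := hg.exists_formula ψ ρ
  exact ⟨χ, C, fun A D v hA hC hv =>
    (hχ A D v).trans (h A _ _ ((hg.adom_subset D).trans hA) hC fun i => hv _)⟩

theorem DefinableMap.comp {F : Instance U τ → Instance U τ'} (hF : DefinableMap F)
    {g : Instance U σ → Instance U τ} (hg : IsReduct g) : DefinableMap fun D => F (g D) := by
  obtain ⟨h, C, hC⟩ := hF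
  exact ⟨fun R => (h R).comp hg fun i => i, C, fun D f hf i =>
    (hC (g D) f hf i).imp_left fun hi => hg.adom_subset D hi⟩

open scoped Classical in
theorem DefinableMap.ite {p : Instance U τ → Prop}
    (hp : Definable fun D (_ : Fin 0 → U) => p D) {F G : Instance U τ → Instance U τ'}
    (hF : DefinableMap F) (hG : DefinableMap G) :
    DefinableMap fun D => if p D then F D else G D := by
  obtain ⟨hF, B, hB⟩ := hF
  obtain ⟨hG, C, hC⟩ := hG
  refine ⟨fun R => ?_, B ∪ C, fun D f hf i => ?_⟩
  · have hp' : Definable fun D (_ : Fin (τ'.arity R) → U) => p D := hp.comp IsReduct.id Fin.elim0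
    refine ((hp'.and (hF R)).or (hp'.neg.and (hG R))).congr fun D v => ?_
    by_cases h : p D <;> simp [h]
  · by_cases h : p D
    · simp only [h, if_true] at hf
      exact (hB D f hf i).imp_right fun h => Finset.mem_union_left _ h
    · simp only [h, if_false] at hf
      exact (hC D f hf i).imp_right fun h => Finset.mem_union_right _ h

theorem DefinableMap.const (E : Instance U τ') : DefinableMap fun _ : Instance U τ => E :=
  ⟨fun R => Definable.mem_instance E R fun i => i,
    E.adom, fun _ f hf i => Or.inr (Instance.mem_adom.2 ⟨f, hf, i, rfl⟩)⟩

/-! ### Independent unions of PDBs -/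

/-- The disjoint union of two schemas. -/
abbrev Schema.sum (τ σ : Schema) : Schema where
  Rel := τ.Rel ⊕ σ.Rel
  arity := Sum.elim τ.arity σ.arity

/-- A fact over a disjoint union of schemas is a fact over one of them. -/
def Fact.sumEquiv (U : Type*) (τ σ : Schema) : Fact U τ ⊕ Fact U σ ≃ Fact U (τ.sum σ) where
  toFun := Sum.elim (fun f => ⟨.inl f.rel, f.args⟩) fun f => ⟨.inr f.rel, f.args⟩
  invFun
    | ⟨.inl R, a⟩ => .inl ⟨R, a⟩
    | ⟨.inr R, a⟩ => .inr ⟨R, a⟩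
  left_inv := by rintro (_ | _) <;> rfl
  right_inv := by rintro ⟨_ | _, _⟩ <;> rfl

namespace Instance

/-- The part of an instance over the first schema. -/
def left (D : Instance U (τ.sum σ)) : Instance U τ :=
  (D.map (Fact.sumEquiv U τ σ).symm.toEmbedding).toLeft

/-- The part of an instance over the second schema. -/
def right (D : Instance U (τ.sum σ)) : Instance U σ :=
  (D.map (Fact.sumEquiv U τ σ).symm.toEmbedding).toRight

/-- The union of two instances over disjoint schemas. -/
def join (D : Instance U τ) (E : Instance U σ) : Instance U (τ.sum σ) :=
  (D.disjSum E).map (Fact.sumEquiv U τ σ).toEmbedding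

theorem mem_left {D : Instance U (τ.sum σ)} {f : Fact U τ} :
    f ∈ D.left ↔ Fact.sumEquiv U τ σ (.inl f) ∈ D := by
  simp [left, Finset.mem_map_equiv]

theorem mem_right {D : Instance U (τ.sum σ)} {f : Fact U σ} :
    f ∈ D.right ↔ Fact.sumEquiv U τ σ (.inr f) ∈ D := by
  simp [right, Finset.mem_map_equiv]

theorem left_join (D : Instance U τ) (E : Instance U σ) : (join D E).left = D := by
  ext f
  simp [mem_left, join]

theorem right_join (D : Instance U τ) (E : Instance U σ) : (join D E).right = E := by
  ext f
  simp [mem_right, join]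

theorem isReduct_left : IsReduct (left : Instance U (τ.sum σ) → Instance U τ) :=
  ⟨Sum.inl, fun _ => rfl, fun _ _ _ => mem_left⟩

theorem isReduct_right : IsReduct (right : Instance U (τ.sum σ) → Instance U σ) :=
  ⟨Sum.inr, fun _ => rfl, fun _ _ _ => mem_right⟩

end Instance

namespace PDB

/-- The sample space of a distribution may be taken to be its support. -/
def ofPMF (P : PMF (Instance U τ)) : PDB U τ := ⟨P.support, P.support_countable, P, subset_rfl⟩

/-- The independent union of two PDBs. -/
noncomputable def prod (D : PDB U τ) (E : PDB U σ) : PDB U (τ.sum σ) :=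
  ofPMF (D.prob.bind fun I => E.prob.map (Instance.join I))

theorem prod_Pr (D : PDB U τ) (E : PDB U σ) (A : Set (Instance U τ)) (B : Set (Instance U σ)) :
    (D.prod E).Pr {I | I.left ∈ A ∧ I.right ∈ B} = D.Pr A * E.Pr B := by
  classical
  have h : ∀ I, (E.prob.map (Instance.join I)).toOuterMeasure {I | I.left ∈ A ∧ I.right ∈ B} =
      A.indicator (fun _ => E.Pr B) I := by
    intro I
    rw [PMF.toOuterMeasure_map_apply]
    by_cases hI : I ∈ A <;>
      simp [Set.preimage, Instance.left_join, Instance.right_join, hI, Pr]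
  simp only [Pr, prod, ofPMF, PMF.toOuterMeasure_bind_apply, h]
  rw [D.prob.toOuterMeasure_apply, ← ENNReal.tsum_mul_right]
  refine tsum_congr fun I => ?_
  by_cases hI : I ∈ A <;> simp [hI]

theorem Pr_univ (D : PDB U τ) : D.Pr Set.univ = 1 :=
  (PMF.toOuterMeasure_apply_eq_one_iff _ _).2 (Set.subset_univ _)

/-- A finite set of facts splits along the two schemas, and containing it is a product event, so
`prod_Pr` reduces the claim to `hD` and `hE`. -/
theorem TupleIndependent.prod {D : PDB U τ} {E : PDB U σ} (hD : D.TupleIndependent)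
    (hE : E.TupleIndependent) : (D.prod E).TupleIndependent := by
  intro S hS
  have hsupp : ∀ I ∈ (D.prod E).prob.support, I.left ∈ D.prob.support ∧
      I.right ∈ E.prob.support := by
    intro I hI
    simp only [PDB.prod, ofPMF, PMF.mem_support_bind_iff, PMF.mem_support_map_iff] at hI
    obtain ⟨J, hJ, K, hK, rfl⟩ := hI
    simpa only [Instance.left_join, Instance.right_join] using And.intro hJ hK
  obtain ⟨T, rfl⟩ : ∃ T : Finset (Fact U τ ⊕ Fact U σ),
      S = T.map (Fact.sumEquiv U τ σ).toEmbedding :=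
    ⟨S.map (Fact.sumEquiv U τ σ).symm.toEmbedding, by simp [Finset.map_map]⟩
  have hl : ∀ f ∈ T.toLeft, f ∈ D.facts := by
    intro f hf
    obtain ⟨I, hI, hfI⟩ := hS (Fact.sumEquiv U τ σ (.inl f)) (by simpa using hf)
    exact ⟨I.left, (hsupp I hI).1, Instance.mem_left.2 hfI⟩
  have hr : ∀ f ∈ T.toRight, f ∈ E.facts := by
    intro f hf
    obtain ⟨I, hI, hfI⟩ := hS (Fact.sumEquiv U τ σ (.inr f)) (by simpa using hf)
    exact ⟨I.right, (hsupp I hI).2, Instance.mem_right.2 hfI⟩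
  have hl' : ∀ f, (D.prod E).Pr {I | Fact.sumEquiv U τ σ (.inl f) ∈ I} = D.Pr {I | f ∈ I} := by
    intro f
    have := D.prod_Pr E {I | f ∈ I} Set.univ
    simpa [Instance.mem_left, Pr_univ] using this
  have hr' : ∀ f, (D.prod E).Pr {I | Fact.sumEquiv U τ σ (.inr f) ∈ I} = E.Pr {I | f ∈ I} := by
    intro f
    have := D.prod_Pr E Set.univ {I | f ∈ I}
    simpa [Instance.mem_right, Pr_univ] using this
  rw [Finset.prod_map, ← Finset.toLeft_disjSum_toRight (u := T), Finset.prod_disjSum]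
  simp only [Equiv.coe_toEmbedding, hl', hr']
  rw [← hD _ hl, ← hE _ hr, ← prod_Pr]
  congr 1
  ext I
  simp only [Set.mem_ofPred_eq]
  rw [← (Fact.sumEquiv U τ σ).forall_congr_right]
  simp [Instance.mem_left, Instance.mem_right]

end PDB

/-! ### Distributions represented by tuple-independent PDBs -/

/-- The distributions of the images of tuple-independent PDBs under FO-views. -/
def TIRepresentable (Q : PMF (Instance U τ')) : Prop :=
  ∃ (σ : Schema) (D : PDB U σ), D.TupleIndependent ∧
    ∃ F : Instance U σ → Instance U τ', DefinableMap F ∧ Q = D.prob.map F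

open scoped Classical in
-- One round of sampling: next to `D` an independent PDB representing `Q` is drawn in any case, and
-- the view reads it only if `p` fails on the left part.
theorem TIRepresentable.ite {D : PDB U τ} (hD : D.TupleIndependent) {p : Instance U τ → Prop}
    (hp : Definable fun D (_ : Fin 0 → U) => p D) {F : Instance U τ → Instance U τ'}
    (hF : DefinableMap F) {Q : PMF (Instance U τ')} (hQ : TIRepresentable Q) :
    TIRepresentable (D.prob.bind fun I => if p I then PMF.pure (F I) else Q) := by
  obtain ⟨σ, E, hE, G, hG, rfl⟩ := hQ
  refine ⟨τ.sum σ, D.prod E, hD.prod hE, fun I => if p I.left then F I.left else G I.right,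
    DefinableMap.ite (hp.comp Instance.isReduct_left fun i => i) (hF.comp Instance.isReduct_left)
      (hG.comp Instance.isReduct_right), ?_⟩
  simp only [PDB.prod, PDB.ofPMF, PMF.map_bind, PMF.map_comp]
  congr 1
  ext1 I
  by_cases h : p I
  · simp only [h, if_true, Function.comp_def, Instance.left_join]
    exact (PMF.map_const _ _).symm
  · simp only [h, if_false, Function.comp_def, Instance.left_join, Instance.right_join]

theorem TIRepresentable.pure {D : PDB U τ} (hD : D.TupleIndependent) (E : Instance U τ') :
    TIRepresentable (PMF.pure E) :=
  ⟨τ, D, hD, fun _ => E, DefinableMap.const E, (PMF.map_const _ _).symm⟩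

end ProbDB

/-! ### Conditioning by finitely many independent samples -/

namespace PMF

variable {α : Type*}

theorem ext_of_forall_ne {P Q : PMF α} (a₀ : α) (h : ∀ a, a ≠ a₀ → P a = Q a) : P = Q := by
  classical
  have key : ∀ R : PMF α, R a₀ + ∑' a, (if a = a₀ then 0 else R a) = 1 := fun R => by
    rw [← R.tsum_coe]
    exact (ENNReal.tsum_eq_add_tsum_ite a₀).symm
  have hsum : (∑' a, if a = a₀ then 0 else P a) = ∑' a, if a = a₀ then 0 else Q a :=
    tsum_congr fun a => by
      by_cases ha : a = a₀
      · simp [ha]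
      · simp [ha, h a ha]
  have hfin : (∑' a, if a = a₀ then 0 else Q a) ≠ ∞ := by
    intro hc
    have := key Q
    simp [hc] at this
  refine PMF.ext fun a => ?_
  by_cases ha : a = a₀
  · subst ha
    have := (key P).trans (key Q).symm
    rw [hsum] at this
    exact (ENNReal.add_left_inj hfin).1 this
  · exact h a ha

theorem toOuterMeasure_union (P : PMF α) {s t : Set α} (h : Disjoint s t) :
    P.toOuterMeasure (s ∪ t) = P.toOuterMeasure s + P.toOuterMeasure t := by
  simp only [toOuterMeasure_apply, ← ENNReal.tsum_add, Set.indicator_union_of_disjoint h]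

open scoped Classical in
/-- The first element of `s` in `k` independent samples, or `a₀` if there is none. -/
noncomputable def firstSuccess (P : PMF α) (s : Set α) (a₀ : α) : ℕ → PMF α
  | 0 => pure a₀
  | k + 1 => P.bind fun a => if a ∈ s then pure a else P.firstSuccess s a₀ k

/-- The i-th summand accounts for i failures followed by the outcome `a`. -/
theorem firstSuccess_apply (P : PMF α) (s : Set α) {a a₀ : α} (ha : a ≠ a₀) (k : ℕ) :
    P.firstSuccess s a₀ k a =
      s.indicator P a * ∑ i ∈ Finset.range k, P.toOuterMeasure sᶜ ^ i := by
  classical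
  induction k with
  | zero => simp [firstSuccess, ha]
  | succ k ih =>
    have h : ∀ b, P b * (if b ∈ s then pure b else P.firstSuccess s a₀ k) a =
        (if b = a then s.indicator P a else 0) +
          sᶜ.indicator P b * P.firstSuccess s a₀ k a := by
      intro b
      by_cases hb : b ∈ s
      · by_cases hba : b = a
        · subst hba
          simp [hb]
        · simp [hb, hba, pure_apply_of_ne _ _ (Ne.symm hba)]
      · by_cases hba : b = a
        · subst hba
          simp [hb]
        · simp [hb, hba]
    rw [firstSuccess, bind_apply, tsum_congr h, ENNReal.tsum_add, ENNReal.tsum_mul_right,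
      ← toOuterMeasure_apply, tsum_ite_eq, ih, geom_sum_succ]
    ring

set_option linter.deprecated false in
/-- A conditioned distribution is a mixture of a point mass and of the first success among
finitely many independent samples. -/
theorem exists_filter_eq_bind (P : PMF α) {t : Set α} {a₀ : α} (ht : a₀ ∈ t)
    (h₀ : a₀ ∈ P.support) :
    ∃ (k : ℕ) (c : NNReal) (hc : c ≤ 1), P.filter t ⟨a₀, ht, h₀⟩ =
      (bernoulli c hc).bind fun b => cond b (P.firstSuccess (t \ {a₀}) a₀ k) (pure a₀) := by
  classical
  set s := t \ {a₀} with hs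
  set p := P.toOuterMeasure t with hp
  set q := P.toOuterMeasure sᶜ with hq
  have hsq : P.toOuterMeasure s + q = 1 := by
    rw [hq, ← toOuterMeasure_union P disjoint_compl_right, Set.union_compl_self]
    exact (toOuterMeasure_apply_eq_one_iff _ _).2 (Set.subset_univ _)
  have hsp : P.toOuterMeasure s + P a₀ = p := by
    rw [← toOuterMeasure_apply_singleton, ← toOuterMeasure_union P Set.disjoint_sdiff_left,
      Set.sdiff_union_of_subset (by simpa using ht)]
  have hsfin : P.toOuterMeasure s ≠ ∞ := fun h => by simp [h] at hsq
  have hqfin : q ≠ ∞ := fun h => by simp [h] at hsq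
  -- The series equals 1/P(s), and P(s) < `p` because `a₀` was taken out of `t` and has positive
  -- mass.
  have hlt : p⁻¹ < ∑' i, q ^ i := by
    rw [ENNReal.tsum_geometric, ENNReal.inv_lt_inv, ← hsq, ENNReal.add_sub_cancel_right hqfin,
      ← hsp]
    exact ENNReal.lt_add_right hsfin ((P.mem_support_iff a₀).1 h₀)
  rw [ENNReal.tsum_eq_iSup_nat, lt_iSup_iff] at hlt
  obtain ⟨k, hk⟩ := hlt
  set g := ∑ i ∈ Finset.range k, q ^ i with hg
  have hg0 : g ≠ 0 := (zero_le.trans_lt hk).ne'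
  have hgfin : g ≠ ∞ := ENNReal.sum_ne_top.2 fun i _ => ENNReal.pow_ne_top hqfin
  have hc1 : p⁻¹ * g⁻¹ ≤ 1 := by
    rw [← ENNReal.mul_inv_cancel hg0 hgfin]
    gcongr
  have hcfin : p⁻¹ * g⁻¹ ≠ ∞ := ne_top_of_le_ne_top ENNReal.one_ne_top hc1
  -- The coin turns the factor `g` of `firstSuccess_apply` into `p⁻¹`, the factor of conditioning.
  refine ⟨k, (p⁻¹ * g⁻¹).toNNReal, ?_, ?_⟩
  · rw [← ENNReal.coe_le_coe, ENNReal.coe_toNNReal hcfin]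
    simpa using hc1
  refine ext_of_forall_ne a₀ fun a ha => ?_
  have hind : s.indicator P a = t.indicator P a := by
    by_cases h : a ∈ t <;> simp [hs, h, ha]
  rw [filter_apply, bind_apply, tsum_bool, ← toOuterMeasure_apply, ← hp]
  simp only [cond_true, cond_false, pure_apply_of_ne _ _ ha, mul_zero, zero_add, bernoulli_apply,
    firstSuccess_apply P s ha, hind]
  rw [ENNReal.coe_toNNReal hcfin, ← hq, ← hg, mul_left_comm, mul_assoc p⁻¹,
    ENNReal.inv_mul_cancel hg0 hgfin, mul_one]

end PMF

/-! ### Conditioned PDBs as images of tuple-independent ones -/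

namespace ProbDB

variable {U : Type*} {τ τ' σ : Schema}

theorem PDB.tupleIndependent_of_subsingleton [Subsingleton (Fact U τ)] (D : PDB U τ) :
    D.TupleIndependent := by
  intro S _
  rcases S.eq_empty_or_nonempty with rfl | ⟨f, hf⟩
  · simpa using D.Pr_univ
  · obtain rfl : S = {f} := by
      ext g
      simp [Subsingleton.elim g f, hf]
    simp

/-- The schema with a single nullary relation. -/
abbrev Schema.nullary : Schema := ⟨Unit, fun _ => 0⟩

instance : Subsingleton (Fact U Schema.nullary) :=
  ⟨fun ⟨_, a⟩ ⟨_, b⟩ => by rw [Subsingleton.elim a b]⟩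

set_option linter.deprecated false in
theorem TIRepresentable.mix_pure {Q : PMF (Instance U τ')} (hQ : TIRepresentable Q)
    (E : Instance U τ') (c : NNReal) (hc : c ≤ 1) :
    TIRepresentable ((PMF.bernoulli c hc).bind fun b => cond b Q (PMF.pure E)) := by
  classical
  -- The coin is the presence of the only possible fact; its absence selects `E`.
  let f : Fact U Schema.nullary := ⟨(), Fin.elim0⟩
  have h := TIRepresentable.ite (PDB.tupleIndependent_of_subsingleton
    (PDB.ofPMF ((PMF.bernoulli c hc).map fun b => cond b {f} ∅)))
    (Definable.mem_fact f).neg (DefinableMap.const E) hQ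
  convert h using 1
  simp only [PDB.ofPMF, PMF.bind_map]
  congr 1
  ext1 b
  cases b <;> simp

theorem TIRepresentable.firstSuccess {D : PDB U τ} (hD : D.TupleIndependent)
    {s : Set (Instance U τ)} (hs : Definable fun I (_ : Fin 0 → U) => I ∈ s)
    {F : Instance U τ → Instance U τ'} (hF : DefinableMap F) (D₀ : Instance U τ) (k : ℕ) :
    TIRepresentable ((D.prob.firstSuccess s D₀ k).map F) := by
  classical
  induction k with
  | zero =>
    rw [PMF.firstSuccess, PMF.pure_map]
    exact TIRepresentable.pure hD _
  | succ k ih =>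
    convert TIRepresentable.ite hD hs hF ih using 1
    rw [PMF.firstSuccess, PMF.map_bind]
    congr 1
    ext1 I
    by_cases h : I ∈ s <;> simp [h, PMF.pure_map]

theorem TIRepresentable.map_filter {D : PDB U τ} (hD : D.TupleIndependent)
    {t : Set (Instance U τ)} (ht : Definable fun I (_ : Fin 0 → U) => I ∈ t)
    {F : Instance U τ → Instance U τ'} (hF : DefinableMap F)
    (h : ∃ I ∈ t, I ∈ D.prob.support) : TIRepresentable ((D.prob.filter t h).map F) := by
  obtain ⟨D₀, h₀, h₁⟩ := h
  obtain ⟨k, c, hc, h⟩ := D.prob.exists_filter_eq_bind h₀ h₁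
  rw [h, PMF.map_bind]
  have hs : Definable fun I (_ : Fin 0 → U) => I ∈ t \ {D₀} :=
    ht.and (Definable.eq_instance D₀).neg
  convert (TIRepresentable.firstSuccess hD hs hF D₀ k).mix_pure (F D₀) c hc using 2
  ext1 b
  cases b <;> simp [PMF.pure_map]

theorem TIRepresentable.mem_FO_TI {E : Σ τ : Schema, PDB U τ} (h : TIRepresentable E.2.prob) :
    E ∈ FO (TI U) := by
  obtain ⟨σ, D, hD, F, hF, hE⟩ := h
  obtain ⟨Φ, rfl⟩ := hF.exists_view
  -- The sample space is shrunk to the support, since instances of probability zero might be mapped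
  -- outside the sample space of `E`.
  refine ⟨⟨σ, PDB.ofPMF D.prob⟩, hD, Φ, fun I hI => E.2.support_subset ?_, hE⟩
  rw [hE, PMF.mem_support_map_iff]
  exact ⟨I, hI, rfl⟩

theorem FO_condFO_TI_subset : FO (CondFO (TI U)) ⊆ FO (TI U) := by
  rintro E ⟨_, ⟨⟨τ, D⟩, hD, φ, h, rfl⟩, Φ, -, hE⟩
  refine TIRepresentable.mem_FO_TI ?_
  rw [hE]
  exact TIRepresentable.map_filter (t := {I | Models I φ}) hD (Definable.models φ) Φ.definableMap
    (D.exists_mem_support h)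

/-- Conditioning on a tautology does nothing. -/
theorem subset_condFO (C : PDBClass U) : C ⊆ CondFO C := by
  rintro ⟨τ, D⟩ hD
  have hφ : ∀ I : Instance U τ, Models I (.all (.eq (.var 0) (.var 0))) := fun I a _ => rfl
  have hset : {I : Instance U τ | Models I (.all (.eq (.var 0) (.var 0)))} = Set.univ :=
    Set.eq_univ_of_forall hφ
  have hpos : 0 < D.Pr {I | Models I (.all (.eq (.var 0) (.var 0)))} := by
    rw [hset, D.Pr_univ]
    exact zero_lt_one
  refine ⟨⟨τ, D⟩, hD, _, hpos, ?_⟩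
  obtain ⟨space, hc, prob, hsub⟩ := D
  have h1 : {I ∈ space | Models I (.all (.eq (.var 0) (.var 0)))} = space :=
    Set.sep_eq_self_iff_mem_true.2 fun I _ => hφ I
  have h2 : ∀ h, prob.filter {I | Models I (.all (.eq (.var 0) (.var 0)))} h = prob := by
    intro h
    ext I
    simp [PMF.filter_apply, hset, prob.tsum_coe]
  simp only [PDB.cond, h1, h2]

end ProbDB

theorem mainTheorem2 (U : Type*) [Countable U] [Infinite U] :
    ProbDB.FO (ProbDB.CondFO (ProbDB.TI U)) = ProbDB.FO (ProbDB.TI U) := by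
  refine Set.Subset.antisymm ProbDB.FO_condFO_TI_subset ?_
  rintro E ⟨D, hD, h⟩
  exact ⟨D, ProbDB.subset_condFO _ hD, h⟩
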